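/- Let $F$ be a free group of finite rank $m$ with basis $x_1,\dots,x_m$, let $e_1,\dots,e_m\ge 0$ be integers with $e_m\mid e_{m-1}\mid\cdots\mid e_1$, and let $S=\langle x_1^{e_1},\dots,x_m^{e_m},\gamma_2(F)\rangle\le F$. Here $\gamma_1(H)=H$ and $\gamma_{n+1}(H)=[\gamma_n(H),H]$ denote the terms of the lower central series of a group $H$. Let $\mathfrak f$ be the augmentation ideal of the integral group ring $\mathbb Z[F]$, and let $\mathfrak s$ be the augmentation ideal of $\mathbb Z[S]\subseteq\mathbb Z[F]$ (powers and products denote the additive subgroups of $\mathbb Z[F]$ generated by the products of elements). Then (i) $F\cap(1+\mathfrak s^2+\mathfrak f^3)=\gamma_2(S)\,\gamma_3(F)$, and (ii) $F\cap(1+\mathfrak s^2\,\mathbb Z[F]+\mathfrak f^4)=\gamma_2(S)\,\gamma_4(F)$. -/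

import Mathlib

open scoped Pointwise

noncomputable section

namespace GenDim

/-- The augmentation map `ℤ[G] → ℤ`, the ring homomorphism sending every group element to `1`. -/
def augmentation (G : Type*) [Group G] : MonoidAlgebra ℤ G →ₐ[ℤ] ℤ :=
  MonoidAlgebra.lift ℤ ℤ G (1 : G →* ℤ)

/-- The augmentation ideal of `ℤ[G]`: the kernel of the augmentation map. -/
def augIdeal (G : Type*) [Group G] : Ideal (MonoidAlgebra ℤ G) :=
  RingHom.ker (augmentation G)

variable {F : Type*} [Group F]

/-- The augmentation ideal of `ℤ[H]` for a subgroup `H` of `F`, regarded inside `ℤ[F]` through the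
inclusion `ℤ[H] ⊆ ℤ[F]`. It is an additive subgroup of `ℤ[F]` (in general not an ideal of `ℤ[F]`),
so it is recorded as a `ℤ`-submodule. Products and powers of such submodules are the additive
subgroups generated by the products of elements. For `H = ⊤` this is the augmentation ideal
of `ℤ[F]`. -/
def aug (H : Subgroup F) : Submodule ℤ (MonoidAlgebra ℤ F) :=
  ((augIdeal H).restrictScalars ℤ).map
    (MonoidAlgebra.mapDomainAlgHom ℤ ℤ H.subtype).toLinearMap

/-- `γ n H` is the `n`-th term (`n ≥ 1`) of the lower central series of the subgroup `H`, with
`γ 1 H = H` and `γ (n + 1) H = [γ n H, H]`. -/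
def γ (n : ℕ) (H : Subgroup F) : Subgroup F :=
  H.lowerCentralSeries (n - 1)

/-- `D n 𝔞 = F ∩ (1 + 𝔞 + 𝔣 ^ n)` (`n ≥ 1`), as a set of elements of `F`, where `𝔣` is the
augmentation ideal of `ℤ[F]`. -/
def D (n : ℕ) (𝔞 : Submodule ℤ (MonoidAlgebra ℤ F)) : Set F :=
  {w | ∃ u ∈ 𝔞 ⊔ aug (⊤ : Subgroup F) ^ n, MonoidAlgebra.of ℤ F w = 1 + u}

/-- The subgroup `S = ⟨x₁ ^ e₁, …, x_m ^ e_m, γ₂(F)⟩` of `F`. -/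
def S {m : ℕ} (x : Fin m → F) (e : Fin m → ℕ) : Subgroup F :=
  Subgroup.closure (Set.range (fun i => x i ^ e i) ∪ (γ 2 (⊤ : Subgroup F) : Set F))

end GenDim

end

open scoped Pointwise commutatorElement IsMulCommutative

noncomputable section

namespace GenDim

variable {F : Type*} [Group F]

/-! The inclusions from right to left follow from `h - 1 ∈ 𝔥ⁿ` for `h ∈ γₙ(H)`. The converse
inclusions read off Magnus coefficients. For each word `abc` in the basis, `F` acts by unitriangular
`4 × 4` matrices whose first row carries the coefficients of `a`, `ab`, `abc`; `𝔣ⁿ` lands in the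
matrices supported on and above the `n`-th superdiagonal.

(i) An element `w` of the left side has no linear coefficients, so `w ∈ γ₂(F)`, and its coefficient
of `ab` is divisible by `e_a e_b`. Modulo `γ₃(F)`, `w` is the product over `a < b` of the `⁅x_a,
x_b⁆`, each raised to the coefficient of `ab`. Modulo `γ₃(F)` also `⁅x_a, x_b⁆ ^ (e_a e_b) = ⁅x_a ^
e_a, x_b ^ e_b⁆`, which lies in `γ₂(S)`.

(ii) By (i), and after removing a factor from `γ₂(S)`, one may take `w ∈ γ₃(F)`. Modulo `γ₄(F)`, `w`
is the product of the `⁅⁅x_c, x_b⁆, x_a⁆`, each raised to the coefficient of `abc`, over words with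
`c < a, b` or `a = b < c`. Since `⁅⁅x_c, x_b⁆, x_a⁆ ^ e_a` agrees modulo `γ₄(F)` with `⁅⁅x_c, x_b⁆,
x_a ^ e_a⁆ ∈ γ₂(S)`, it suffices that `e_a` divides these coefficients. If `c < a`, this follows
from `e_a ∣ e_c`. For `aac` it needs a finer congruence involving `e_a.choose 2`, whose error term
is killed by the vanishing of the coefficient of `ac` (`dvd_magnusPart_square_of_mem_D_four`). -/

/-! ### Augmentation ideals of subgroups and their powers. -/

theorem of_sub_one_mem_aug {H : Subgroup F} {h : F} (hh : h ∈ H) :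
    MonoidAlgebra.of ℤ F h - 1 ∈ aug H := by
  refine ⟨MonoidAlgebra.of ℤ H ⟨h, hh⟩ - 1, ?_, ?_⟩
  · simp [augIdeal, augmentation, RingHom.mem_ker]
  · change MonoidAlgebra.mapDomainAlgHom ℤ ℤ H.subtype _ = _
    rw [map_sub, map_one]
    simp [MonoidAlgebra.of_apply]

theorem aug_eq_span (H : Subgroup F) :
    aug H = Submodule.span ℤ ((fun h : F => MonoidAlgebra.of ℤ F h - 1) '' (H : Set F)) := by
  refine le_antisymm ?_ (Submodule.span_le.2 ?_)
  · rintro _ ⟨u, hu, rfl⟩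
    -- Subtracting the augmentation makes the claim linear in an arbitrary element of `ℤ[H]`, so it
    -- can be checked on group elements.
    have key : ∀ v : MonoidAlgebra ℤ H,
        MonoidAlgebra.mapDomainAlgHom ℤ ℤ H.subtype v
          - algebraMap ℤ (MonoidAlgebra ℤ F) (augmentation H v) ∈
        Submodule.span ℤ ((fun h : F => MonoidAlgebra.of ℤ F h - 1) '' (H : Set F)) := by
      intro v
      induction v using MonoidAlgebra.induction_on with
      | of h =>
        refine Submodule.subset_span ⟨h, h.2, ?_⟩
        simp [augmentation, MonoidAlgebra.of_apply]
      | add f g hf hg =>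
        simp only [map_add]
        convert add_mem hf hg using 1
        abel
      | smul r f hf =>
        simp only [map_smul]
        convert Submodule.smul_mem _ r hf using 1
        simp [smul_sub]
    have h0 : augmentation H u = 0 := hu
    have := key u
    rw [h0, map_zero, sub_zero] at this
    exact this
  · rintro _ ⟨h, hh, rfl⟩
    exact of_sub_one_mem_aug hh

theorem aug_mono {H K : Subgroup F} (h : H ≤ K) : aug H ≤ aug K := by
  rw [aug_eq_span, aug_eq_span]
  exact Submodule.span_mono (Set.image_mono h)

theorem aug_mul_aug_le (H : Subgroup F) : aug H * aug H ≤ aug H := by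
  conv_lhs => rw [aug_eq_span, Submodule.span_mul_span]
  rw [Submodule.span_le]
  rintro _ ⟨_, ⟨a, ha, rfl⟩, _, ⟨b, hb, rfl⟩, rfl⟩
  have : (MonoidAlgebra.of ℤ F a - 1) * (MonoidAlgebra.of ℤ F b - 1) =
      (MonoidAlgebra.of ℤ F (a * b) - 1) - (MonoidAlgebra.of ℤ F a - 1) -
        (MonoidAlgebra.of ℤ F b - 1) := by
    rw [map_mul]; noncomm_ring
  simp only [SetLike.mem_coe]
  rw [this]
  exact sub_mem (sub_mem (of_sub_one_mem_aug (mul_mem ha hb)) (of_sub_one_mem_aug ha))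
    (of_sub_one_mem_aug hb)

theorem aug_pow_succ_le (H : Subgroup F) {n : ℕ} (hn : n ≠ 0) : aug H ^ (n + 1) ≤ aug H ^ n := by
  obtain ⟨k, rfl⟩ := Nat.exists_eq_succ_of_ne_zero hn
  calc aug H ^ (k + 1 + 1) = aug H ^ k * (aug H * aug H) := by rw [pow_succ, pow_succ, mul_assoc]
    _ ≤ aug H ^ k * aug H := mul_le_mul_right (aug_mul_aug_le H) _
    _ = _ := (pow_succ _ _).symm

theorem aug_pow_le_aug_pow (H : Subgroup F) {n k : ℕ} (hn : n ≠ 0) (h : n ≤ k) :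
    aug H ^ k ≤ aug H ^ n := by
  induction k, h using Nat.le_induction with
  | base => exact le_rfl
  | succ k hk ih => exact (aug_pow_succ_le H (by omega)).trans ih

/-- Powers of `aug H` are stable under right multiplication by elements of `H`. -/
theorem mul_of_mem_aug_pow {H : Subgroup F} {n : ℕ} (hn : n ≠ 0) {u : MonoidAlgebra ℤ F}
    (hu : u ∈ aug H ^ n) {h : F} (hh : h ∈ H) : u * MonoidAlgebra.of ℤ F h ∈ aug H ^ n := by
  have : u * MonoidAlgebra.of ℤ F h = u + u * (MonoidAlgebra.of ℤ F h - 1) := by noncomm_ring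
  rw [this]
  refine add_mem hu (aug_pow_succ_le H hn ?_)
  rw [pow_succ]
  exact Submodule.mul_mem_mul hu (of_sub_one_mem_aug hh)

/-- Both sides equal `(gh - hg)g⁻¹h⁻¹`: the ring commutator of `g - 1` and `h - 1` is that of `g`
and `h`. -/
theorem of_commutator_sub_one (g h : F) :
    MonoidAlgebra.of ℤ F ⁅g, h⁆ - 1 =
      ((MonoidAlgebra.of ℤ F g - 1) * (MonoidAlgebra.of ℤ F h - 1) -
        (MonoidAlgebra.of ℤ F h - 1) * (MonoidAlgebra.of ℤ F g - 1)) *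
        MonoidAlgebra.of ℤ F (g⁻¹ * h⁻¹) := by
  have e1 : MonoidAlgebra.of ℤ F ⁅g, h⁆ = MonoidAlgebra.of ℤ F (g * h) *
      MonoidAlgebra.of ℤ F (g⁻¹ * h⁻¹) := by
    rw [← map_mul, commutatorElement_def, mul_assoc, mul_assoc]
  have e2 : (1 : MonoidAlgebra ℤ F) = MonoidAlgebra.of ℤ F (h * g) *
      MonoidAlgebra.of ℤ F (g⁻¹ * h⁻¹) := by
    rw [← map_mul]; simp [MonoidAlgebra.one_def]
  have e3 : (MonoidAlgebra.of ℤ F g - 1) * (MonoidAlgebra.of ℤ F h - 1) -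
        (MonoidAlgebra.of ℤ F h - 1) * (MonoidAlgebra.of ℤ F g - 1) =
      MonoidAlgebra.of ℤ F (g * h) - MonoidAlgebra.of ℤ F (h * g) := by
    rw [map_mul, map_mul]; noncomm_ring
  rw [e3, sub_mul, ← e1, ← e2]

theorem of_sub_one_mem_aug_pow {H : Subgroup F} (n : ℕ) {h : F}
    (hh : h ∈ H.lowerCentralSeries n) : MonoidAlgebra.of ℤ F h - 1 ∈ aug H ^ (n + 1) := by
  induction n generalizing h with
  | zero => simpa using of_sub_one_mem_aug hh
  | succ n ih =>
    have hle : ∀ n, H.lowerCentralSeries n ≤ H := by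
      intro n
      induction n with
      | zero => exact le_rfl
      | succ n ih => exact (Subgroup.commutator_mono ih le_rfl).trans (Subgroup.commutator_le_self H)
    change h ∈ ⁅H.lowerCentralSeries n, H⁆ at hh
    -- Membership in `H` is carried along because `𝔥ⁿ` is only known to be stable under right
    -- multiplication by elements of `H`.
    suffices h ∈ H ∧ MonoidAlgebra.of ℤ F h - 1 ∈ aug H ^ (n + 1 + 1) from this.2
    rw [Subgroup.commutator_def] at hh
    induction hh using Subgroup.closure_induction with
    | mem x hx =>
      obtain ⟨a, ha, b, hb, rfl⟩ := hx
      refine ⟨(Subgroup.commutator_le_self H) (Subgroup.commutator_mem_commutator (hle n ha) hb), ?_⟩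
      rw [of_commutator_sub_one]
      refine mul_of_mem_aug_pow (by omega) (sub_mem ?_ ?_)
        (mul_mem (inv_mem (hle n ha)) (inv_mem hb))
      · rw [pow_succ]
        exact Submodule.mul_mem_mul (ih ha) (of_sub_one_mem_aug hb)
      · rw [pow_succ']
        exact Submodule.mul_mem_mul (of_sub_one_mem_aug hb) (ih ha)
    | one => exact ⟨one_mem _, by rw [map_one, sub_self]; exact zero_mem _⟩
    | mul x y _ _ hx hy =>
      refine ⟨mul_mem hx.1 hy.1, ?_⟩
      have : MonoidAlgebra.of ℤ F (x * y) - 1 =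
        (MonoidAlgebra.of ℤ F x - 1) * MonoidAlgebra.of ℤ F y + (MonoidAlgebra.of ℤ F y - 1) := by
        rw [map_mul]; noncomm_ring
      rw [this]
      exact add_mem (mul_of_mem_aug_pow (by omega) hx.2 hy.1) hy.2
    | inv x _ hx =>
      refine ⟨inv_mem hx.1, ?_⟩
      have : MonoidAlgebra.of ℤ F x⁻¹ - 1 =
        -((MonoidAlgebra.of ℤ F x - 1) * MonoidAlgebra.of ℤ F x⁻¹) := by
        rw [sub_mul, ← map_mul, mul_inv_cancel, map_one, one_mul, neg_sub]
      rw [this]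
      exact neg_mem (mul_of_mem_aug_pow (by omega) hx.2 (inv_mem hx.1))

/-! ### The easy inclusions. -/

theorem mem_D_iff {n : ℕ} {𝔞 : Submodule ℤ (MonoidAlgebra ℤ F)} {w : F} :
    w ∈ D n 𝔞 ↔ MonoidAlgebra.of ℤ F w - 1 ∈ 𝔞 ⊔ aug (⊤ : Subgroup F) ^ n := by
  constructor
  · rintro ⟨u, hu, h⟩
    rw [h, add_sub_cancel_left]; exact hu
  · intro h
    exact ⟨_, h, by abel⟩

theorem of_mul_sub_one (x y : F) : MonoidAlgebra.of ℤ F (x * y) - 1 =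
    (MonoidAlgebra.of ℤ F x - 1) * MonoidAlgebra.of ℤ F y + (MonoidAlgebra.of ℤ F y - 1) := by
  rw [map_mul]; noncomm_ring

theorem of_sub_one_mem_aug_sq {H : Subgroup F} {h : F} (hh : h ∈ γ 2 H) :
    MonoidAlgebra.of ℤ F h - 1 ∈ aug H ^ 2 :=
  of_sub_one_mem_aug_pow 1 hh

theorem γ_mul_γ_subset_D_three (H : Subgroup F) :
    (γ 2 H : Set F) * (γ 3 (⊤ : Subgroup F) : Set F) ⊆ D 3 (aug H ^ 2) := by
  rintro _ ⟨s, hs, v, hv, rfl⟩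
  have hs' := of_sub_one_mem_aug_sq hs
  have hv' : MonoidAlgebra.of ℤ F v - 1 ∈ aug (⊤ : Subgroup F) ^ 3 := of_sub_one_mem_aug_pow 2 hv
  simp only [mem_D_iff]
  -- `𝔰²` need not be stable under multiplication by `v ∈ F`, so the cross term is split off; it
  -- lies in `𝔣⁴ ⊆ 𝔣³`.
  have : MonoidAlgebra.of ℤ F (s * v) - 1 = (MonoidAlgebra.of ℤ F s - 1) +
    ((MonoidAlgebra.of ℤ F s - 1) * (MonoidAlgebra.of ℤ F v - 1) +
      (MonoidAlgebra.of ℤ F v - 1)) := by rw [map_mul]; noncomm_ring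
  rw [this]
  refine Submodule.add_mem_sup hs' (add_mem ?_ hv')
  refine aug_pow_le_aug_pow ⊤ (by norm_num) (by norm_num : 3 ≤ 4) ?_
  rw [pow_succ']
  exact Submodule.mul_mem_mul (of_sub_one_mem_aug (Subgroup.mem_top s)) hv'

/-- Here `sv - 1 = (s - 1)v + (v - 1)` and `𝔰² ℤ[F]` absorbs `v`. Besides the easy inclusion, this
lets a factor from `γ₂(S)` be removed in the proof of (ii). -/
theorem mul_mem_D {H : Subgroup F} {n : ℕ} {s v : F} (hs : s ∈ γ 2 H)
    (hv : v ∈ D n (aug H ^ 2 * (⊤ : Submodule ℤ (MonoidAlgebra ℤ F)))) :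
    s * v ∈ D n (aug H ^ 2 * (⊤ : Submodule ℤ (MonoidAlgebra ℤ F))) := by
  rw [mem_D_iff] at hv ⊢
  rw [of_mul_sub_one]
  exact add_mem (Submodule.mem_sup_left (Submodule.mul_mem_mul (of_sub_one_mem_aug_sq hs) trivial))
    hv

theorem γ_mul_γ_subset_D_four (H : Subgroup F) :
    (γ 2 H : Set F) * (γ 4 (⊤ : Subgroup F) : Set F) ⊆
      D 4 (aug H ^ 2 * (⊤ : Submodule ℤ (MonoidAlgebra ℤ F))) := by
  rintro _ ⟨s, hs, v, hv, rfl⟩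
  refine mul_mem_D hs (mem_D_iff.2 (Submodule.mem_sup_right ?_))
  exact of_sub_one_mem_aug_pow 3 hv

/-- For `u ∈ 𝔰²` one has `uh = u + u(h - 1)` with `u(h - 1) ∈ 𝔣³`. This makes (i) available in the
proof of (ii). -/
theorem D_four_subset_D_three (H : Subgroup F) :
    D 4 (aug H ^ 2 * (⊤ : Submodule ℤ (MonoidAlgebra ℤ F))) ⊆ D 3 (aug H ^ 2) := by
  intro w hw
  rw [mem_D_iff] at hw ⊢
  refine (sup_le ?_ ?_ :
    aug H ^ 2 * ⊤ ⊔ aug (⊤ : Subgroup F) ^ 4 ≤ aug H ^ 2 ⊔ aug (⊤ : Subgroup F) ^ 3) hw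
  · rw [Submodule.mul_le]
    intro u hu v _
    induction v using MonoidAlgebra.induction_on with
    | of h =>
      have : u * MonoidAlgebra.of ℤ F h = u + u * (MonoidAlgebra.of ℤ F h - 1) := by noncomm_ring
      rw [this]
      refine Submodule.add_mem_sup hu ?_
      rw [pow_succ]
      refine Submodule.mul_mem_mul ?_ (of_sub_one_mem_aug (Subgroup.mem_top h))
      exact pow_le_pow_left' (aug_mono le_top) 2 hu
    | add f g hf hg => rw [mul_add]; exact add_mem (hf trivial) (hg trivial)
    | smul r f hf => rw [mul_smul_comm]; exact Submodule.smul_mem _ r (hf trivial)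
  · exact (aug_pow_le_aug_pow ⊤ (by norm_num) (by norm_num : 3 ≤ 4)).trans le_sup_right

/-! ### Generation by the basis, and banded `4 × 4` matrices. -/

theorem closure_range_basis {ι : Type*} (x : FreeGroupBasis ι F) : Subgroup.closure (Set.range x) = ⊤ := by
  have h := congrArg (Subgroup.map x.repr.symm.toMonoidHom) (FreeGroup.closure_range_of ι)
  rw [MonoidHom.map_closure, ← Set.range_comp,
    Subgroup.map_top_of_surjective _ x.repr.symm.surjective] at h
  exact h

/-- The `4 × 4` matrices whose entries vanish below the `k`-th superdiagonal. -/
def upperBand (k : ℕ) : Submodule ℤ (Matrix (Fin 4) (Fin 4) ℤ) where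
  carrier := {A | ∀ i j : Fin 4, (j : ℕ) < i + k → A i j = 0}
  add_mem' hA hB i j h := by simp [hA i j h, hB i j h]
  zero_mem' i j h := rfl
  smul_mem' r A hA i j h := by simp [hA i j h]

theorem mul_mem_upperBand {k l : ℕ} {A B : Matrix (Fin 4) (Fin 4) ℤ} (hA : A ∈ upperBand k)
    (hB : B ∈ upperBand l) : A * B ∈ upperBand (k + l) := by
  intro i j h
  rw [Matrix.mul_apply]
  refine Finset.sum_eq_zero fun t _ => ?_
  by_cases ht : (t : ℕ) < i + k
  · rw [hA i t ht, zero_mul]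
  · rw [hB t j (by omega), mul_zero]

theorem upperBand_antitone : Antitone upperBand :=
  fun _ _ h _ hA i j hij => hA i j (by omega)

theorem mul_apply_zero_two {A B : Matrix (Fin 4) (Fin 4) ℤ} (hA : A ∈ upperBand 1)
    (hB : B ∈ upperBand 1) : (A * B) 0 2 = A 0 1 * B 1 2 := by
  simp [Matrix.mul_apply, Fin.sum_univ_four, hA 0 0 (by decide), hB 2 2 (by decide),
    hB 3 2 (by decide)]

theorem mul_apply_one_three {A B : Matrix (Fin 4) (Fin 4) ℤ} (hA : A ∈ upperBand 1)
    (hB : B ∈ upperBand 1) : (A * B) 1 3 = A 1 2 * B 2 3 := by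
  simp [Matrix.mul_apply, Fin.sum_univ_four, hA 1 0 (by decide), hA 1 1 (by decide),
    hB 3 3 (by decide)]

theorem mul_apply_zero_three {A B : Matrix (Fin 4) (Fin 4) ℤ} (hA : A ∈ upperBand 1)
    (hB : B ∈ upperBand 1) : (A * B) 0 3 = A 0 1 * B 1 3 + A 0 2 * B 2 3 := by
  simp [Matrix.mul_apply, Fin.sum_univ_four, hA 0 0 (by decide), hB 3 3 (by decide)]

/-! ### The Magnus representation of a three-letter word. -/

section Magnus

variable {ι : Type*} [DecidableEq ι]

/-- The strictly upper triangular part of the image of the generator `i` under the Magnus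
representation attached to the word `abc`. -/
def letterMatrix (a b c i : ι) : Matrix (Fin 4) (Fin 4) ℤ :=
  !![0, if i = a then 1 else 0, 0, 0;
     0, 0, if i = b then 1 else 0, 0;
     0, 0, 0, if i = c then 1 else 0;
     0, 0, 0, 0]

theorem letterMatrix_mem_upperBand (a b c i : ι) : letterMatrix a b c i ∈ upperBand 1 := by
  intro r s h
  fin_cases r <;> fin_cases s <;> first | rfl | (exfalso; revert h; decide)

theorem upperBand_four_eq_zero {A : Matrix (Fin 4) (Fin 4) ℤ} (hA : A ∈ upperBand 4) : A = 0 := by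
  ext i j
  exact hA i j (by omega)

theorem letterMatrix_pow_four (a b c i : ι) : letterMatrix a b c i ^ 4 = 0 := by
  have h := letterMatrix_mem_upperBand a b c i
  refine upperBand_four_eq_zero ?_
  rw [pow_succ, pow_succ, pow_two]
  exact mul_mem_upperBand (mul_mem_upperBand (mul_mem_upperBand h h) h) h

/-- The unipotent matrix `1 + N`, for `N` the matrix attached to the letter `i`. -/
def letterUnit (a b c i : ι) : (Matrix (Fin 4) (Fin 4) ℤ)ˣ where
  val := 1 + letterMatrix a b c i
  inv := 1 - letterMatrix a b c i * (1 - letterMatrix a b c i + letterMatrix a b c i ^ 2)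
  val_inv := by
    have : (1 + letterMatrix a b c i) *
        (1 - letterMatrix a b c i * (1 - letterMatrix a b c i + letterMatrix a b c i ^ 2)) =
        1 - letterMatrix a b c i ^ 4 := by noncomm_ring
    rw [this, letterMatrix_pow_four, sub_zero]
  inv_val := by
    have : (1 - letterMatrix a b c i * (1 - letterMatrix a b c i + letterMatrix a b c i ^ 2)) *
        (1 + letterMatrix a b c i) = 1 - letterMatrix a b c i ^ 4 := by noncomm_ring
    rw [this, letterMatrix_pow_four, sub_zero]

/-- The Magnus representation attached to the word `abc`: the entries `(0, 1)`, `(0, 2)` and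
`(0, 3)` of the image of an element are the coefficients of `a`, `ab` and `abc` in its Magnus
expansion. -/
def magnus (x : FreeGroupBasis ι F) (a b c : ι) :
    MonoidAlgebra ℤ F →ₐ[ℤ] Matrix (Fin 4) (Fin 4) ℤ :=
  MonoidAlgebra.lift ℤ (Matrix (Fin 4) (Fin 4) ℤ) F
    ((Units.coeHom _).comp (x.lift (letterUnit a b c)))

section

variable (x : FreeGroupBasis ι F) (a b c : ι)

/-- The image of `g - 1` under the Magnus representation attached to the word `abc`. -/
def magnusPart (g : F) : Matrix (Fin 4) (Fin 4) ℤ :=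
  magnus x a b c (MonoidAlgebra.of ℤ F g - 1)

theorem magnus_of (g : F) : magnus x a b c (MonoidAlgebra.of ℤ F g) = 1 + magnusPart x a b c g := by
  rw [magnusPart, map_sub, map_one]; abel

theorem magnusPart_basis (i : ι) : magnusPart x a b c (x i) = letterMatrix a b c i := by
  have : x.lift (letterUnit a b c) (x i) = letterUnit a b c i :=
    congrFun (x.lift.symm_apply_apply (letterUnit a b c)) i
  rw [magnusPart, map_sub, map_one, magnus, MonoidAlgebra.lift_of, MonoidHom.comp_apply, this]
  simp [letterUnit]

theorem magnusPart_one : magnusPart x a b c (1 : F) = 0 := by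
  rw [magnusPart, map_one, sub_self, map_zero]

theorem magnusPart_mul (g h : F) : magnusPart x a b c (g * h) =
    magnusPart x a b c g + magnusPart x a b c h + magnusPart x a b c g * magnusPart x a b c h := by
  simp only [magnusPart, ← map_mul, ← map_add]
  congr 1
  rw [map_mul]; noncomm_ring

theorem magnusPart_mem_upperBand_one (g : F) : magnusPart x a b c g ∈ upperBand 1 := by
  have hg : g ∈ Subgroup.closure (Set.range x) := by rw [closure_range_basis]; trivial
  -- The product formula does not pass directly from `g` to `g⁻¹`, so both are carried through the
  -- induction.
  suffices magnusPart x a b c g ∈ upperBand 1 ∧ magnusPart x a b c g⁻¹ ∈ upperBand 1 from this.1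
  have hle : upperBand 2 ≤ upperBand 1 := upperBand_antitone (by norm_num)
  induction hg using Subgroup.closure_induction with
  | mem _ h =>
    obtain ⟨i, rfl⟩ := h
    have hN := letterMatrix_mem_upperBand a b c i
    refine ⟨by rw [magnusPart_basis]; exact hN, ?_⟩
    have e1 := magnusPart_mul x a b c (x i) (x i)⁻¹
    have e2 : x.lift (letterUnit a b c) (x i) = letterUnit a b c i :=
      congrFun (x.lift.symm_apply_apply (letterUnit a b c)) i
    have e3 : magnusPart x a b c (x i)⁻¹ =
        -(letterMatrix a b c i * (1 - letterMatrix a b c i + letterMatrix a b c i ^ 2)) := by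
      rw [magnusPart, map_sub, map_one, magnus, MonoidAlgebra.lift_of, MonoidHom.comp_apply,
        map_inv, e2]
      simp [letterUnit]
    rw [e3, mul_add, mul_sub, mul_one, pow_two]
    have h2 := mul_mem_upperBand hN hN
    exact neg_mem (add_mem (sub_mem hN (hle h2))
      (upperBand_antitone (by norm_num : 1 ≤ 1 + (1 + 1)) (mul_mem_upperBand hN h2)))
  | one => simp [magnusPart_one]
  | mul g h _ _ hg hh =>
    rw [mul_inv_rev, magnusPart_mul, magnusPart_mul]
    exact ⟨add_mem (add_mem hg.1 hh.1) (hle (mul_mem_upperBand hg.1 hh.1)),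
      add_mem (add_mem hh.2 hg.2) (hle (mul_mem_upperBand hh.2 hg.2))⟩
  | inv g _ hg => rw [inv_inv]; exact ⟨hg.2, hg.1⟩

/-- Each `g - 1` becomes strictly upper triangular, and band indices add under products. In
particular `𝔣⁴` is killed. -/
theorem magnus_mem_upperBand {n : ℕ} (hn : n ≠ 0) {u : MonoidAlgebra ℤ F}
    (hu : u ∈ aug (⊤ : Subgroup F) ^ n) : magnus x a b c u ∈ upperBand n := by
  suffices aug (⊤ : Subgroup F) ^ n ≤ (upperBand n).comap (magnus x a b c).toLinearMap from this hu
  clear hu u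
  have h1 : aug (⊤ : Subgroup F) ≤ (upperBand 1).comap (magnus x a b c).toLinearMap := by
    rw [aug_eq_span, Submodule.span_le]
    rintro _ ⟨h, _, rfl⟩
    exact magnusPart_mem_upperBand_one x a b c h
  induction n, Nat.one_le_iff_ne_zero.2 hn using Nat.le_induction with
  | base => rw [pow_one]; exact h1
  | succ n hn' ih =>
    rw [pow_succ, Submodule.mul_le]
    intro u hu v hv
    have := mul_mem_upperBand (ih (by omega) hu) (h1 hv)
    simpa using this

theorem magnusPart_mem_upperBand (n : ℕ) {g : F}
    (hg : g ∈ (⊤ : Subgroup F).lowerCentralSeries n) : magnusPart x a b c g ∈ upperBand (n + 1) :=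
  magnus_mem_upperBand x a b c (by omega) (of_sub_one_mem_aug_pow n hg)

theorem magnusPart_commutator (g h : F) : magnusPart x a b c ⁅g, h⁆ =
    (magnusPart x a b c g * magnusPart x a b c h - magnusPart x a b c h * magnusPart x a b c g) *
      (1 + magnusPart x a b c (g⁻¹ * h⁻¹)) := by
  rw [magnusPart, of_commutator_sub_one, map_mul, magnus_of]
  simp only [magnusPart, ← map_mul, ← map_sub]

/-- The leading term of a group commutator is the Lie bracket of the leading terms; the unipotent
factor in `magnusPart_commutator` only affects higher bands. -/
theorem magnusPart_commutator_sub_mem {k l : ℕ} {g h : F} (hg : magnusPart x a b c g ∈ upperBand k)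
    (hh : magnusPart x a b c h ∈ upperBand l) :
    magnusPart x a b c ⁅g, h⁆ - (magnusPart x a b c g * magnusPart x a b c h -
      magnusPart x a b c h * magnusPart x a b c g) ∈ upperBand (k + l + 1) := by
  rw [magnusPart_commutator, mul_add, mul_one, add_sub_cancel_left]
  refine mul_mem_upperBand (sub_mem (mul_mem_upperBand hg hh) ?_)
    (magnusPart_mem_upperBand_one x a b c _)
  rw [add_comm]
  exact mul_mem_upperBand hh hg

theorem magnusPart_commutator_zero_two (g h : F) : magnusPart x a b c ⁅g, h⁆ 0 2 =
    magnusPart x a b c g 0 1 * magnusPart x a b c h 1 2 -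
      magnusPart x a b c h 0 1 * magnusPart x a b c g 1 2 := by
  have hg := magnusPart_mem_upperBand_one x a b c g
  have hh := magnusPart_mem_upperBand_one x a b c h
  have := magnusPart_commutator_sub_mem x a b c hg hh 0 2 (by decide)
  rw [Matrix.sub_apply, Matrix.sub_apply, mul_apply_zero_two hg hh, mul_apply_zero_two hh hg] at this
  exact sub_eq_zero.1 this

theorem magnusPart_commutator_one_three (g h : F) : magnusPart x a b c ⁅g, h⁆ 1 3 =
    magnusPart x a b c g 1 2 * magnusPart x a b c h 2 3 -
      magnusPart x a b c h 1 2 * magnusPart x a b c g 2 3 := by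
  have hg := magnusPart_mem_upperBand_one x a b c g
  have hh := magnusPart_mem_upperBand_one x a b c h
  have := magnusPart_commutator_sub_mem x a b c hg hh 1 3 (by decide)
  rw [Matrix.sub_apply, Matrix.sub_apply, mul_apply_one_three hg hh,
    mul_apply_one_three hh hg] at this
  exact sub_eq_zero.1 this

theorem magnusPart_commutator_zero_three {g : F} (hg : magnusPart x a b c g ∈ upperBand 2) (h : F) :
    magnusPart x a b c ⁅g, h⁆ 0 3 =
    magnusPart x a b c g 0 2 * magnusPart x a b c h 2 3 -
      magnusPart x a b c h 0 1 * magnusPart x a b c g 1 3 := by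
  have hg' := magnusPart_mem_upperBand_one x a b c g
  have hh := magnusPart_mem_upperBand_one x a b c h
  have := magnusPart_commutator_sub_mem x a b c hg hh 0 3 (by decide)
  rw [Matrix.sub_apply, Matrix.sub_apply, mul_apply_zero_three hg' hh,
    mul_apply_zero_three hh hg', hg 0 1 (by decide), hg 2 3 (by decide)] at this
  linarith

theorem magnusPart_mul_zero_one (g h : F) : magnusPart x a b c (g * h) 0 1 =
    magnusPart x a b c g 0 1 + magnusPart x a b c h 0 1 := by
  have := mul_mem_upperBand (magnusPart_mem_upperBand_one x a b c g)
    (magnusPart_mem_upperBand_one x a b c h) 0 1 (by decide)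
  simp [magnusPart_mul, this]

theorem magnusPart_mul_one_two (g h : F) : magnusPart x a b c (g * h) 1 2 =
    magnusPart x a b c g 1 2 + magnusPart x a b c h 1 2 := by
  have := mul_mem_upperBand (magnusPart_mem_upperBand_one x a b c g)
    (magnusPart_mem_upperBand_one x a b c h) 1 2 (by decide)
  simp [magnusPart_mul, this]

theorem magnusPart_mul_two_three (g h : F) : magnusPart x a b c (g * h) 2 3 =
    magnusPart x a b c g 2 3 + magnusPart x a b c h 2 3 := by
  have := mul_mem_upperBand (magnusPart_mem_upperBand_one x a b c g)
    (magnusPart_mem_upperBand_one x a b c h) 2 3 (by decide)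
  simp [magnusPart_mul, this]

theorem magnusPart_mul_zero_two (g h : F) : magnusPart x a b c (g * h) 0 2 =
    magnusPart x a b c g 0 2 + magnusPart x a b c h 0 2 +
      magnusPart x a b c g 0 1 * magnusPart x a b c h 1 2 := by
  rw [magnusPart_mul, Matrix.add_apply, Matrix.add_apply,
    mul_apply_zero_two (magnusPart_mem_upperBand_one x a b c g)
      (magnusPart_mem_upperBand_one x a b c h)]

theorem magnusPart_mul_apply {k : ℕ} {g h : F} (hg : magnusPart x a b c g ∈ upperBand k)
    (hh : magnusPart x a b c h ∈ upperBand k) {i j : Fin 4} (hij : (j : ℕ) < i + (k + k)) :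
    magnusPart x a b c (g * h) i j = magnusPart x a b c g i j + magnusPart x a b c h i j := by
  rw [magnusPart_mul, Matrix.add_apply, Matrix.add_apply, mul_mem_upperBand hg hh i j hij, add_zero]

end

end Magnus

/-! ### Commutator calculus with central commutators. -/

section CentralCommutators

variable {Q : Type*} [Group Q]

theorem mul_mul_inv_of_mem_center {z : Q} (hz : z ∈ Subgroup.center Q) (g : Q) :
    g * z * g⁻¹ = z := by
  rw [Subgroup.mem_center_iff.1 hz g, mul_inv_cancel_right]

theorem inv_mul_mul_of_mem_center {z : Q} (hz : z ∈ Subgroup.center Q) (g : Q) :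
    g⁻¹ * z * g = z := by
  simpa using mul_mul_inv_of_mem_center hz g⁻¹

theorem commutator_mem_center_comm {g h : Q} (hc : ⁅g, h⁆ ∈ Subgroup.center Q) :
    ⁅h, g⁆ ∈ Subgroup.center Q := by
  rw [← commutatorElement_inv]; exact inv_mem hc

theorem commutator_inv_left_of_mem_center {g h : Q} (hc : ⁅g, h⁆ ∈ Subgroup.center Q) :
    ⁅g⁻¹, h⁆ = ⁅g, h⁆⁻¹ := by
  rw [commutatorElement_inv_left, inv_mul_mul_of_mem_center (commutator_mem_center_comm hc),
    commutatorElement_inv]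

theorem commutator_pow_right_of_mem_center {g h : Q} (hc : ⁅g, h⁆ ∈ Subgroup.center Q) (n : ℕ) :
    ⁅g, h ^ n⁆ = ⁅g, h⁆ ^ n := by
  induction n with
  | zero => simp
  | succ n ih =>
    rw [pow_succ, commutatorElement_mul_right_eq_mul_conj, mul_assoc, mul_assoc, ← mul_assoc (h ^ n),
      mul_mul_inv_of_mem_center hc, ih, pow_succ]

theorem commutator_pow_left_of_mem_center {g h : Q} (hc : ⁅g, h⁆ ∈ Subgroup.center Q) (n : ℕ) :
    ⁅g ^ n, h⁆ = ⁅g, h⁆ ^ n := by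
  rw [← commutatorElement_inv, commutator_pow_right_of_mem_center (commutator_mem_center_comm hc),
    ← inv_pow, commutatorElement_inv]

variable (hc : ∀ a b c : Q, ⁅⁅a, b⁆, c⁆ ∈ Subgroup.center Q)
include hc

theorem triple_commutator_swap (a b c : Q) : ⁅⁅a, b⁆, c⁆ = ⁅⁅b, a⁆, c⁆⁻¹ := by
  rw [← commutator_inv_left_of_mem_center (hc b a c), commutatorElement_inv]

theorem triple_commutator_inv_left (a b c : Q) : ⁅⁅a⁻¹, b⁆, c⁆ = ⁅⁅a, b⁆, c⁆⁻¹ := by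
  -- The first factor is a triple commutator, hence central, and drops out of the commutator with
  -- `c`.
  have h1 : ⁅a⁻¹, b⁆ = ⁅a⁻¹, ⁅b, a⁆⁆ * ⁅b, a⁆ := by
    simp [commutatorElement_def, mul_assoc]
  have h2 : ⁅a⁻¹, ⁅b, a⁆⁆ ∈ Subgroup.center Q := commutator_mem_center_comm (hc _ _ _)
  have h3 : ⁅⁅a⁻¹, ⁅b, a⁆⁆, c⁆ = 1 :=
    commutatorElement_eq_one_iff_mul_comm.2 (Subgroup.mem_center_iff.1 h2 c).symm
  rw [h1, commutatorElement_mul_left_eq_conj_mul, h3, mul_one,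
    mul_mul_inv_of_mem_center (hc b a c), triple_commutator_swap hc]

/-- This is the Hall–Witt identity: centrality removes the conjugations, and the inverses inside
come out. -/
theorem triple_commutator_jacobi (a b c : Q) :
    ⁅⁅a, b⁆, c⁆ * ⁅⁅c, a⁆, b⁆ * ⁅⁅b, c⁆, a⁆ = 1 := by
  have h := conj_commutatorElement_left_commutatorElement_mul a b c
  have e1 := mul_mul_inv_of_mem_center (hc a⁻¹ b c) a
  have e2 := mul_mul_inv_of_mem_center (hc c⁻¹ a b) c
  have e3 := mul_mul_inv_of_mem_center (hc b⁻¹ c a) b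
  have h' : (a * ⁅⁅a⁻¹, b⁆, c⁆ * a⁻¹) * (c * ⁅⁅c⁻¹, a⁆, b⁆ * c⁻¹) * (b * ⁅⁅b⁻¹, c⁆, a⁆ * b⁻¹) = 1 := by
    simpa only [mul_assoc] using h
  rw [e1, e2, e3, triple_commutator_inv_left hc, triple_commutator_inv_left hc,
    triple_commutator_inv_left hc, ← mul_inv_rev, ← mul_inv_rev, inv_eq_one,
    Subgroup.mem_center_iff.1 (mul_mem (hc c a b) (hc a b c)),
    Subgroup.mem_center_iff.1 (hc a b c)] at h'
  exact h'

end CentralCommutators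

/-! ### Generators of the lower central quotients. -/

section Generation

theorem commutator_mem_lowerCentralSeries_succ {n : ℕ} {z : F}
    (hz : z ∈ (⊤ : Subgroup F).lowerCentralSeries n) (g : F) :
    ⁅z, g⁆ ∈ (⊤ : Subgroup F).lowerCentralSeries (n + 1) :=
  Subgroup.commutator_mem_commutator hz (Subgroup.mem_top g)

/-- If `X` generates `F` and `Y` generates the `n`-th term of the lower central series, then the
commutators `⁅y, x⁆` generate the next term modulo the one after. -/
theorem lowerCentralSeries_succ_le_closure {n : ℕ} {X Y : Set F}
    (hX : Subgroup.closure X = ⊤) (hY : (⊤ : Subgroup F).lowerCentralSeries n = Subgroup.closure Y) :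
    (⊤ : Subgroup F).lowerCentralSeries (n + 1) ≤
      Subgroup.closure (Set.image2 (fun y x => ⁅y, x⁆) Y X ∪
        ((⊤ : Subgroup F).lowerCentralSeries (n + 2) : Set F)) := by
  set E := Subgroup.closure (Set.image2 (fun y x => ⁅y, x⁆) Y X ∪
        ((⊤ : Subgroup F).lowerCentralSeries (n + 2) : Set F)) with hE
  have hle : (⊤ : Subgroup F).lowerCentralSeries (n + 2) ≤ E := fun z hz =>
    Subgroup.subset_closure (Or.inr hz)
  -- Conjugation changes an element of a term of the series by an element of the next term, which
  -- `E` contains. This replaces normality of `E`.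
  have hconj : ∀ z ∈ (⊤ : Subgroup F).lowerCentralSeries (n + 1), z ∈ E → ∀ a : F,
      a * z * a⁻¹ ∈ E := by
    intro z hz hzE a
    have : a * z * a⁻¹ = ⁅z, a⁆⁻¹ * z := by simp [commutatorElement_def, mul_assoc]
    rw [this]
    exact mul_mem (inv_mem (hle (commutator_mem_lowerCentralSeries_succ hz a))) hzE
  have h1 : ∀ y ∈ Y, ∀ h : F, ⁅y, h⁆ ∈ E := by
    intro y hy h
    have hy' : y ∈ (⊤ : Subgroup F).lowerCentralSeries n := hY ▸ Subgroup.subset_closure hy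
    have hh : h ∈ Subgroup.closure X := hX ▸ Subgroup.mem_top h
    induction hh using Subgroup.closure_induction with
    | mem x hx => exact Subgroup.subset_closure (Or.inl ⟨y, hy, x, hx, rfl⟩)
    | one => simp
    | mul a b _ _ ha hb =>
      rw [commutatorElement_mul_right_eq_mul_conj, mul_assoc, mul_assoc, ← mul_assoc a]
      exact mul_mem ha (hconj _ (commutator_mem_lowerCentralSeries_succ hy' b) hb a)
    | inv a _ ha =>
      rw [commutatorElement_inv_right, ← commutatorElement_inv]
      have := hconj _ (inv_mem (commutator_mem_lowerCentralSeries_succ hy' a)) (inv_mem ha) a⁻¹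
      rwa [inv_inv] at this
  rw [Subgroup.lowerCentralSeries_succ, Subgroup.commutator_le]
  intro g hg h _
  have hmem : ∀ a ∈ Subgroup.closure Y, ∀ b : F,
      ⁅a, b⁆ ∈ (⊤ : Subgroup F).lowerCentralSeries (n + 1) := fun a ha b =>
    commutator_mem_lowerCentralSeries_succ (hY ▸ ha) b
  rw [hY] at hg
  induction hg using Subgroup.closure_induction with
  | mem y hy => exact h1 y hy h
  | one => simp
  | mul a b _ hb' ha hb =>
    rw [commutatorElement_mul_left_eq_conj_mul]
    exact mul_mem (hconj _ (hmem b hb' h) hb a) ha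
  | inv a ha' ha =>
    rw [commutatorElement_inv_left, ← commutatorElement_inv]
    have := hconj _ (inv_mem (hmem a ha' h)) (inv_mem ha) a⁻¹
    rwa [inv_inv] at this

theorem lowerCentralSeries_one_eq_closure {X : Set F} (hX : Subgroup.closure X = ⊤) :
    (⊤ : Subgroup F).lowerCentralSeries 1 =
      Subgroup.closure (Set.image2 (fun y x => ⁅y, x⁆) X X ∪
        ((⊤ : Subgroup F).lowerCentralSeries 2 : Set F)) := by
  refine le_antisymm (lowerCentralSeries_succ_le_closure (n := 0) hX hX.symm) ?_
  rw [Subgroup.closure_le]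
  rintro _ (⟨y, _, z, _, rfl⟩ | h)
  · exact commutator_mem_lowerCentralSeries_succ (n := 0) (Subgroup.mem_top y) z
  · exact Subgroup.lowerCentralSeries_antitone _ (by norm_num : 1 ≤ 2) h

theorem lowerCentralSeries_two_le_closure {X : Set F} (hX : Subgroup.closure X = ⊤) :
    (⊤ : Subgroup F).lowerCentralSeries 2 ≤
      Subgroup.closure (Set.image2 (fun y x => ⁅y, x⁆) (Set.image2 (fun y x => ⁅y, x⁆) X X) X ∪
        ((⊤ : Subgroup F).lowerCentralSeries 3 : Set F)) := by
  refine (lowerCentralSeries_succ_le_closure (n := 1) hX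
    (lowerCentralSeries_one_eq_closure hX)).trans ?_
  rw [Subgroup.closure_le]
  rintro _ (⟨y, hy | hy, z, hz, rfl⟩ | h)
  · exact Subgroup.subset_closure (Or.inl ⟨y, hy, z, hz, rfl⟩)
  · exact Subgroup.subset_closure (Or.inr (commutator_mem_lowerCentralSeries_succ hy z))
  · exact Subgroup.subset_closure (Or.inr h)

end Generation

/-! ### Coordinates on central sections of `F`. -/

section CentralQuotient

variable {H N : Subgroup F} [N.Normal] (hHN : ⁅H, (⊤ : Subgroup F)⁆ ≤ N)

theorem mk_mem_center (hHN : ⁅H, (⊤ : Subgroup F)⁆ ≤ N) {h : F} (hh : h ∈ H) :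
    (h : F ⧸ N) ∈ Subgroup.center (F ⧸ N) := by
  rw [Subgroup.mem_center_iff]
  intro g
  induction g using QuotientGroup.induction_on with
  | H g =>
    have : ((⁅h, g⁆ : F) : F ⧸ N) = 1 :=
      (QuotientGroup.eq_one_iff _).2 (hHN (Subgroup.commutator_mem_commutator hh trivial))
    exact (commutatorElement_eq_one_iff_mul_comm.1 this).symm

/-- The image of a subgroup `H` of `F` in the center of `F ⧸ N`, if `⁅H, F⁆ ≤ N`. -/
def toCenter : H →* Subgroup.center (F ⧸ N) :=
  ((QuotientGroup.mk' N).comp H.subtype).codRestrict _ fun h => mk_mem_center hHN h.2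

theorem coe_toCenter (h : H) : (toCenter hHN h : F ⧸ N) = ((h : F) : F ⧸ N) := rfl

theorem toCenter_eq_one_iff (h : H) : toCenter hHN h = 1 ↔ (h : F) ∈ N := by
  rw [← Subtype.coe_inj, coe_toCenter]
  exact QuotientGroup.eq_one_iff _

/-- A system of coordinates for the image of `H` in the center of `F ⧸ N` can be checked on
generators of `H`. -/
theorem toCenter_eq_prod {κ : Type*} [Fintype κ] (c : κ → F → ℤ)
    (hc : ∀ i, ∀ g ∈ H, ∀ h ∈ H, c i (g * h) = c i g + c i h)
    (B : κ → Subgroup.center (F ⧸ N)) {X : Set F} (hX : H ≤ Subgroup.closure X)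
    (hXH : ∀ w ∈ X, ∃ hw : w ∈ H, toCenter hHN ⟨w, hw⟩ = ∏ i, B i ^ c i w)
    {w : F} (hw : w ∈ H) : toCenter hHN ⟨w, hw⟩ = ∏ i, B i ^ c i w := by
  have hone : ∀ i, c i 1 = 0 := fun i => by
    have := hc i 1 (one_mem H) 1 (one_mem H)
    rw [mul_one] at this
    omega
  suffices ∃ hw : w ∈ H, toCenter hHN ⟨w, hw⟩ = ∏ i, B i ^ c i w from this.2
  have hw' := hX hw
  clear hw
  induction hw' using Subgroup.closure_induction with
  | mem w hw => exact hXH w hw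
  | one =>
    refine ⟨one_mem _, ?_⟩
    simp only [hone, zpow_zero, Finset.prod_const_one]
    exact map_one (toCenter hHN)
  | mul a b _ _ ha hb =>
    obtain ⟨ha, ha'⟩ := ha
    obtain ⟨hb, hb'⟩ := hb
    refine ⟨mul_mem ha hb, ?_⟩
    simp only [hc _ a ha b hb, zpow_add, Finset.prod_mul_distrib, ← ha', ← hb']
    exact map_mul (toCenter hHN) ⟨a, ha⟩ ⟨b, hb⟩
  | inv a _ ha =>
    obtain ⟨ha, ha'⟩ := ha
    refine ⟨inv_mem ha, ?_⟩
    have : ∀ i, c i a⁻¹ = -c i a := fun i => by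
      have := hc i a ha a⁻¹ (inv_mem ha)
      rw [mul_inv_cancel, hone] at this
      omega
    simp only [this, zpow_neg, Finset.prod_inv_distrib, ← ha']
    exact map_inv (toCenter hHN) ⟨a, ha⟩

theorem prod_zpow_ite_eq {A κ : Type*} [CommGroup A] [Fintype κ] [DecidableEq κ] (B : κ → A)
    (j : κ) : ∏ i, B i ^ (if i = j then (1 : ℤ) else 0) = B j := by
  rw [Finset.prod_eq_single j]
  · simp
  · intro i _ hi; simp [hi]
  · simp

end CentralQuotient

/-! ### Linear conditions satisfied by Magnus images. -/

section

variable {ι : Type*} [DecidableEq ι] (x : FreeGroupBasis ι F) (a b c : ι)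

theorem magnus_mem_of_mem_aug {H : Subgroup F} {P : Submodule ℤ (Matrix (Fin 4) (Fin 4) ℤ)}
    (hP : ∀ y ∈ H, magnusPart x a b c y ∈ P) {u : MonoidAlgebra ℤ F} (hu : u ∈ aug H) :
    magnus x a b c u ∈ P := by
  suffices aug H ≤ P.comap (magnus x a b c).toLinearMap from this hu
  rw [aug_eq_span, Submodule.span_le]
  rintro _ ⟨y, hy, rfl⟩
  exact hP y hy

theorem magnus_mem_of_mem_aug_sq {H : Subgroup F} {P W : Submodule ℤ (Matrix (Fin 4) (Fin 4) ℤ)}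
    (hP : ∀ y ∈ H, magnusPart x a b c y ∈ P) (hW : ∀ A ∈ P, ∀ B ∈ P, A * B ∈ W)
    {u : MonoidAlgebra ℤ F} (hu : u ∈ aug H ^ 2) : magnus x a b c u ∈ W := by
  suffices aug H ^ 2 ≤ W.comap (magnus x a b c).toLinearMap from this hu
  rw [pow_two, Submodule.mul_le]
  intro u hu v hv
  have := hW _ (magnus_mem_of_mem_aug x a b c hP hu) _ (magnus_mem_of_mem_aug x a b c hP hv)
  simpa using this

theorem magnusPart_mem_of_mem_D_three {H : Subgroup F}
    {P W : Submodule ℤ (Matrix (Fin 4) (Fin 4) ℤ)}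
    (hP : ∀ y ∈ H, magnusPart x a b c y ∈ P) (hW : ∀ A ∈ P, ∀ B ∈ P, A * B ∈ W)
    (hW' : upperBand 3 ≤ W) {w : F} (hw : w ∈ D 3 (aug H ^ 2)) : magnusPart x a b c w ∈ W := by
  rw [mem_D_iff, Submodule.mem_sup] at hw
  obtain ⟨u, hu, v, hv, h⟩ := hw
  rw [magnusPart, ← h, map_add]
  exact add_mem (magnus_mem_of_mem_aug_sq x a b c hP hW hu)
    (hW' (magnus_mem_upperBand x a b c (by norm_num) hv))

/-- The factor `1 + C` accounts for right multiplication by group elements, which span `ℤ[F]`; `𝔣⁴`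
contributes nothing. -/
theorem magnusPart_mem_of_mem_D_four {H : Subgroup F}
    {P W : Submodule ℤ (Matrix (Fin 4) (Fin 4) ℤ)}
    (hP : ∀ y ∈ H, magnusPart x a b c y ∈ P)
    (hW : ∀ A ∈ P, ∀ B ∈ P, ∀ C ∈ upperBand 1, A * B * (1 + C) ∈ W)
    {w : F} (hw : w ∈ D 4 (aug H ^ 2 * (⊤ : Submodule ℤ (MonoidAlgebra ℤ F)))) :
    magnusPart x a b c w ∈ W := by
  rw [mem_D_iff, Submodule.mem_sup] at hw
  obtain ⟨u, hu, v, hv, h⟩ := hw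
  rw [magnusPart, ← h, map_add, upperBand_four_eq_zero (magnus_mem_upperBand x a b c (by norm_num) hv),
    add_zero]
  suffices aug H ^ 2 * ⊤ ≤ W.comap (magnus x a b c).toLinearMap from this hu
  rw [Submodule.mul_le]
  intro u hu v _
  induction v using MonoidAlgebra.induction_on with
  | of h =>
    rw [Submodule.mem_comap, AlgHom.toLinearMap_apply, map_mul, magnus_of]
    refine magnus_mem_of_mem_aug_sq x a b c
      (W := W.comap (LinearMap.mulRight ℤ (1 + magnusPart x a b c h))) hP ?_ hu
    exact fun A hA B hB => hW A hA B hB _ (magnusPart_mem_upperBand_one x a b c h)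
  | add f g hf hg => rw [mul_add]; exact add_mem (hf trivial) (hg trivial)
  | smul r f hf => rw [mul_smul_comm]; exact Submodule.smul_mem _ r (hf trivial)

theorem magnusPart_pow_zero_one (i : ι) (n : ℕ) :
    magnusPart x a b c (x i ^ n) 0 1 = n * if i = a then 1 else 0 := by
  induction n with
  | zero => simp [magnusPart_one]
  | succ n ih =>
    rw [pow_succ, magnusPart_mul_zero_one, ih, magnusPart_basis]
    by_cases h : i = a <;> simp [letterMatrix, h]

theorem magnusPart_pow_one_two (i : ι) (n : ℕ) :
    magnusPart x a b c (x i ^ n) 1 2 = n * if i = b then 1 else 0 := by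
  induction n with
  | zero => simp [magnusPart_one]
  | succ n ih =>
    rw [pow_succ, magnusPart_mul_one_two, ih, magnusPart_basis]
    by_cases h : i = b <;> simp [letterMatrix, h]

theorem magnusPart_pow_two_three (i : ι) (n : ℕ) :
    magnusPart x a b c (x i ^ n) 2 3 = n * if i = c then 1 else 0 := by
  induction n with
  | zero => simp [magnusPart_one]
  | succ n ih =>
    rw [pow_succ, magnusPart_mul_two_three, ih, magnusPart_basis]
    by_cases h : i = c <;> simp [letterMatrix, h]

/-- This is the quadratic coefficient of `(1 + X)ⁿ`. -/
theorem magnusPart_pow_zero_two (i : ι) (n : ℕ) :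
    magnusPart x a a c (x i ^ n) 0 2 = (n.choose 2 : ℤ) * if i = a then 1 else 0 := by
  induction n with
  | zero => simp [magnusPart_one]
  | succ n ih =>
    rw [pow_succ, magnusPart_mul_zero_two, ih, magnusPart_pow_zero_one, magnusPart_basis,
      Nat.choose_succ_succ' n 1]
    by_cases h : i = a <;> simp [letterMatrix, h]
    ring

theorem magnusPart_one_two_eq_zero_one (g : F) :
    magnusPart x a a c g 1 2 = magnusPart x a a c g 0 1 := by
  have hg : g ∈ Subgroup.closure (Set.range x) := by rw [closure_range_basis]; trivial
  induction hg using Subgroup.closure_induction with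
  | mem _ h =>
    obtain ⟨i, rfl⟩ := h
    rw [magnusPart_basis]
    simp [letterMatrix]
  | one => simp [magnusPart_one]
  | mul g h _ _ hg hh => rw [magnusPart_mul_zero_one, magnusPart_mul_one_two, hg, hh]
  | inv g _ hg =>
    have h1 := magnusPart_mul_zero_one x a a c g g⁻¹
    have h2 := magnusPart_mul_one_two x a a c g g⁻¹
    rw [mul_inv_cancel, magnusPart_one, Matrix.zero_apply] at h1 h2
    linarith

/-- The coefficient of `aa` in the Magnus expansion of an element of `γ 2 F` vanishes. -/
theorem magnusPart_zero_two_eq_zero {g : F} (hg : g ∈ γ 2 (⊤ : Subgroup F)) :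
    magnusPart x a a c g 0 2 = 0 := by
  change g ∈ ⁅(⊤ : Subgroup F), (⊤ : Subgroup F)⁆ at hg
  have h01 : ∀ g ∈ ⁅(⊤ : Subgroup F), (⊤ : Subgroup F)⁆, magnusPart x a a c g 0 1 = 0 :=
    fun g hg => magnusPart_mem_upperBand x a a c 1 hg 0 1 (by decide)
  rw [Subgroup.commutator_def] at hg h01
  induction hg using Subgroup.closure_induction with
  | mem _ h =>
    obtain ⟨g, _, h, _, rfl⟩ := h
    -- With equal letters the coefficient is an antisymmetric expression in commuting integers,
    -- hence zero.
    rw [magnusPart_commutator_zero_two, magnusPart_one_two_eq_zero_one,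
      magnusPart_one_two_eq_zero_one]
    ring
  | one => simp [magnusPart_one]
  | mul g h hg' _ hg hh => rw [magnusPart_mul_zero_two, hg, hh, h01 g hg']; ring
  | inv g hg' hg =>
    have h := magnusPart_mul_zero_two x a a c g g⁻¹
    rw [mul_inv_cancel, magnusPart_one, Matrix.zero_apply, hg, h01 g hg'] at h
    linarith

/-- The matrices in `upperBand 1` whose entries on the first superdiagonal are divisible by the
given integers. -/
def divisibleBand (p q r : ℤ) : Submodule ℤ (Matrix (Fin 4) (Fin 4) ℤ) where
  carrier := {A | A ∈ upperBand 1 ∧ p ∣ A 0 1 ∧ q ∣ A 1 2 ∧ r ∣ A 2 3}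
  add_mem' hA hB := ⟨add_mem hA.1 hB.1, dvd_add hA.2.1 hB.2.1, dvd_add hA.2.2.1 hB.2.2.1,
    dvd_add hA.2.2.2 hB.2.2.2⟩
  zero_mem' := ⟨zero_mem _, dvd_zero _, dvd_zero _, dvd_zero _⟩
  smul_mem' k A hA := ⟨Submodule.smul_mem _ k hA.1, by simpa using hA.2.1.mul_left k,
    by simpa using hA.2.2.1.mul_left k, by simpa using hA.2.2.2.mul_left k⟩

/-- The matrices with the entry `(i, j)` divisible by `d`. -/
def divisibleEntry (i j : Fin 4) (d : ℤ) : Submodule ℤ (Matrix (Fin 4) (Fin 4) ℤ) where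
  carrier := {A | d ∣ A i j}
  add_mem' hA hB := dvd_add hA hB
  zero_mem' := dvd_zero d
  smul_mem' k A hA := (Dvd.dvd.mul_left hA k : d ∣ k * A i j)

/-- The matrices satisfying the congruences that hold for the image of `y - 1`, `y ∈ S`, under the
Magnus representation attached to a word `aac`. -/
def squareBand (p h r : ℤ) : Submodule ℤ (Matrix (Fin 4) (Fin 4) ℤ) where
  carrier := {A | A ∈ upperBand 1 ∧ ∃ s t z, A 0 1 = p * s ∧ A 1 2 = p * s ∧ A 2 3 = r * t ∧
    A 0 2 = h * s + p * z}
  add_mem' := by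
    rintro A B ⟨hA, s, t, z, h1, h2, h3, h4⟩ ⟨hB, s', t', z', h1', h2', h3', h4'⟩
    refine ⟨add_mem hA hB, s + s', t + t', z + z', ?_⟩
    simp only [Matrix.add_apply, h1, h2, h3, h4, h1', h2', h3', h4']
    refine ⟨?_, ?_, ?_, ?_⟩ <;> ring
  zero_mem' := ⟨zero_mem _, 0, 0, 0, by simp⟩
  smul_mem' := by
    rintro k A ⟨hA, s, t, z, h1, h2, h3, h4⟩
    refine ⟨Submodule.smul_mem _ k hA, k * s, k * t, k * z, ?_⟩
    simp only [Matrix.smul_apply, h1, h2, h3, h4, smul_eq_mul]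
    refine ⟨?_, ?_, ?_, ?_⟩ <;> ring

/-- The matrices satisfying the congruences that hold for the image of `𝔰² ℤ[F]` under the Magnus
representation attached to a word `aac`. -/
def squareEntries (p h r : ℤ) : Submodule ℤ (Matrix (Fin 4) (Fin 4) ℤ) where
  carrier := {A | ∃ n z, A 1 3 = p * r * n ∧ A 0 3 = h * r * n + p * z}
  add_mem' := by
    rintro A B ⟨n, z, h1, h2⟩ ⟨n', z', h1', h2'⟩
    refine ⟨n + n', z + z', ?_⟩
    simp only [Matrix.add_apply, h1, h2, h1', h2']
    refine ⟨?_, ?_⟩ <;> ring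
  zero_mem' := ⟨0, 0, by simp⟩
  smul_mem' := by
    rintro k A ⟨n, z, h1, h2⟩
    refine ⟨k * n, k * z, ?_⟩
    simp only [Matrix.smul_apply, h1, h2, smul_eq_mul]
    refine ⟨?_, ?_⟩ <;> ring

end

/-! ### Divisibility of Magnus coefficients for the subgroup `S`. -/

section

variable {m : ℕ} (x : FreeGroupBasis (Fin m) F) (e : Fin m → ℕ) (a b c : Fin m)

theorem magnusPart_mem_divisibleBand {y : F} (hy : y ∈ S x e) :
    magnusPart x a b c y ∈ divisibleBand (e a) (e b) (e c) := by
  refine ⟨magnusPart_mem_upperBand_one x a b c y, ?_⟩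
  induction hy using Subgroup.closure_induction with
  | mem y hy =>
    obtain ⟨i, rfl⟩ | hy := hy
    · simp only [magnusPart_pow_zero_one, magnusPart_pow_one_two, magnusPart_pow_two_three]
      refine ⟨?_, ?_, ?_⟩ <;> split_ifs with h <;> simp [h]
    · have := magnusPart_mem_upperBand x a b c 1 hy
      simp [this 0 1 (by decide), this 1 2 (by decide), this 2 3 (by decide)]
  | one => simp [magnusPart_one]
  | mul y z _ _ hy hz =>
    rw [magnusPart_mul_zero_one, magnusPart_mul_one_two, magnusPart_mul_two_three]
    exact ⟨dvd_add hy.1 hz.1, dvd_add hy.2.1 hz.2.1, dvd_add hy.2.2 hz.2.2⟩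
  | inv y _ hy =>
    have h1 := magnusPart_mul_zero_one x a b c y y⁻¹
    have h2 := magnusPart_mul_one_two x a b c y y⁻¹
    have h3 := magnusPart_mul_two_three x a b c y y⁻¹
    rw [mul_inv_cancel, magnusPart_one, Matrix.zero_apply] at h1 h2 h3
    rw [← neg_eq_of_add_eq_zero_right h1.symm, ← neg_eq_of_add_eq_zero_right h2.symm,
      ← neg_eq_of_add_eq_zero_right h3.symm, dvd_neg, dvd_neg, dvd_neg]
    exact hy

theorem magnusPart_mem_squareBand {y : F} (hy : y ∈ S x e) :
    magnusPart x a a c y ∈ squareBand (e a) ((e a).choose 2 : ℕ) (e c) := by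
  refine ⟨magnusPart_mem_upperBand_one x a a c y, ?_⟩
  induction hy using Subgroup.closure_induction with
  | mem y hy =>
    obtain ⟨i, rfl⟩ | hy := hy
    · simp only [magnusPart_pow_zero_one, magnusPart_pow_one_two, magnusPart_pow_two_three,
        magnusPart_pow_zero_two]
      refine ⟨if i = a then 1 else 0, if i = c then 1 else 0, 0, ?_, ?_, ?_, ?_⟩ <;>
        split_ifs with h <;> simp [h]
    · have := magnusPart_mem_upperBand x a a c 1 hy
      refine ⟨0, 0, 0, ?_⟩
      simp [this 0 1 (by decide), this 1 2 (by decide), this 2 3 (by decide),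
        magnusPart_zero_two_eq_zero x a c hy]
  | one => exact ⟨0, 0, 0, by simp [magnusPart_one]⟩
  | mul y z _ _ hy hz =>
    obtain ⟨s, t, k, h1, h2, h3, h4⟩ := hy
    obtain ⟨s', t', k', h1', h2', h3', h4'⟩ := hz
    -- The last summand of the third witness absorbs the cross term `(e_a s)(e_a s')` in the
    -- coefficient of `aa`.
    refine ⟨s + s', t + t', k + k' + s * (e a * s'), ?_⟩
    rw [magnusPart_mul_zero_one, magnusPart_mul_one_two, magnusPart_mul_two_three,
      magnusPart_mul_zero_two, h1, h2, h3, h4, h1', h2', h3', h4']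
    refine ⟨?_, ?_, ?_, ?_⟩ <;> ring
  | inv y _ hy =>
    obtain ⟨s, t, k, h1, h2, h3, h4⟩ := hy
    have h1' := magnusPart_mul_zero_one x a a c y y⁻¹
    have h2' := magnusPart_mul_one_two x a a c y y⁻¹
    have h3' := magnusPart_mul_two_three x a a c y y⁻¹
    have h4' := magnusPart_mul_zero_two x a a c y y⁻¹
    rw [mul_inv_cancel, magnusPart_one, Matrix.zero_apply] at h1' h2' h3' h4'
    refine ⟨-s, -t, -k + s * (e a * s), by linarith, by linarith, by linarith, ?_⟩
    have h5 : magnusPart x a a c y⁻¹ 1 2 = -(e a * s) := by linarith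
    rw [h5, h1, h4] at h4'
    linarith

theorem dvd_magnusPart_of_mem_D_three {w : F} (hw : w ∈ D 3 (aug (S x e) ^ 2)) :
    (e a * e b : ℤ) ∣ magnusPart x a b c w 0 2 := by
  refine magnusPart_mem_of_mem_D_three x a b c (W := divisibleEntry 0 2 (e a * e b))
    (fun y hy => magnusPart_mem_divisibleBand x e a b c hy) ?_ ?_ hw
  · rintro A ⟨hA, h1, _⟩ B ⟨hB, _, h2, _⟩
    change _ ∣ (A * B) 0 2
    rw [mul_apply_zero_two hA hB]
    exact mul_dvd_mul h1 h2
  · intro A hA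
    change _ ∣ A 0 2
    rw [hA 0 2 (by decide)]
    exact dvd_zero _

theorem magnusPart_zero_one_of_mem_D_three {H : Subgroup F} {w : F} (hw : w ∈ D 3 (aug H ^ 2)) :
    magnusPart x a b c w 0 1 = 0 :=
  magnusPart_mem_of_mem_D_three x a b c (P := upperBand 1) (W := upperBand 2)
    (fun y _ => magnusPart_mem_upperBand_one x a b c y) (fun _ hA _ hB => mul_mem_upperBand hA hB)
    (upperBand_antitone (by norm_num)) hw 0 1 (by decide)

/-- The `(0, 3)` entry of `AB(1 + C)` is `A₀₁B₁₃ + A₀₂B₂₃ + A₀₁B₁₂C₂₃`. The outer terms are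
divisible by `e_a` through `A₀₁`, the middle one through `e_c ∣ B₂₃`. -/
theorem dvd_magnusPart_of_mem_D_four (hac : e a ∣ e c) {w : F}
    (hw : w ∈ D 4 (aug (S x e) ^ 2 * (⊤ : Submodule ℤ (MonoidAlgebra ℤ F)))) :
    (e a : ℤ) ∣ magnusPart x a b c w 0 3 := by
  refine magnusPart_mem_of_mem_D_four x a b c (W := divisibleEntry 0 3 (e a))
    (fun y hy => magnusPart_mem_divisibleBand x e a b c hy) ?_ hw
  rintro A ⟨hA, h1, _⟩ B ⟨hB, _, _, h2⟩ C hC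
  have h2' : (e a : ℤ) ∣ B 2 3 := (Int.natCast_dvd_natCast.2 hac).trans h2
  have hAB := upperBand_antitone (by norm_num : 1 ≤ 1 + 1) (mul_mem_upperBand hA hB)
  change _ ∣ (A * B * (1 + C)) 0 3
  rw [mul_add, mul_one, Matrix.add_apply, mul_apply_zero_three hA hB, mul_apply_zero_three hAB hC,
    mul_apply_zero_two hA hB, mul_mem_upperBand hA hB 0 1 (by decide)]
  refine dvd_add (dvd_add (h1.mul_right _) (h2'.mul_left _)) ?_
  rw [zero_mul, zero_add, mul_assoc]
  exact h1.mul_right _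

/-- Without `e_a ∣ e_c`, the term `A₀₂B₂₃` leaves the residue `(e_a.choose 2) e_c n` modulo `e_a`.
The same `n` gives the coefficient `e_a e_c n` of `ac`, the entry `(1, 3)`, which vanishes on
`γ₃(F)`. -/
theorem dvd_magnusPart_square_of_mem_D_four {w : F}
    (hw : w ∈ D 4 (aug (S x e) ^ 2 * (⊤ : Submodule ℤ (MonoidAlgebra ℤ F))))
    (hw' : w ∈ γ 3 (⊤ : Subgroup F)) : (e a : ℤ) ∣ magnusPart x a a c w 0 3 := by
  have h := magnusPart_mem_of_mem_D_four x a a c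
    (W := squareEntries (e a) ((e a).choose 2 : ℕ) (e c))
    (fun y hy => magnusPart_mem_squareBand x e a c hy) ?_ hw
  · obtain ⟨n, z, h1, h2⟩ := h
    rw [magnusPart_mem_upperBand x a a c 2 hw' 1 3 (by decide)] at h1
    -- From `e_a e_c n = 0` some factor is zero; if it is `e_a`, then the binomial coefficient
    -- vanishes too.
    have h3 : (((e a).choose 2 : ℕ) : ℤ) * e c * n = 0 := by
      rcases mul_eq_zero.1 h1.symm with h | h
      · rcases mul_eq_zero.1 h with h | h
        · have : e a = 0 := by exact_mod_cast h
          simp [this]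
        · simp [h]
      · simp [h]
    rw [h2, h3, zero_add]
    exact dvd_mul_right _ _
  · rintro A ⟨hA, s, t, z, h1, h2, h3, h4⟩ B ⟨hB, s', t', z', h1', h2', h3', h4'⟩ C hC
    have hAB := upperBand_antitone (by norm_num : 1 ≤ 1 + 1) (mul_mem_upperBand hA hB)
    refine ⟨s * t', s * B 1 3 + z * (e c * t') + s * (e a * s') * C 2 3, ?_, ?_⟩
    · rw [mul_add, mul_one, Matrix.add_apply, mul_apply_one_three hA hB, mul_apply_one_three hAB hC,
        mul_mem_upperBand hA hB 1 2 (by decide), h2, h3']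
      ring
    · rw [mul_add, mul_one, Matrix.add_apply, mul_apply_zero_three hA hB,
        mul_apply_zero_three hAB hC, mul_apply_zero_two hA hB,
        mul_mem_upperBand hA hB 0 1 (by decide), h1, h4, h3', h2']
      ring

end

/-! ### Recovering elements from their Magnus coefficients. -/

section

variable {ι : Type*} [Fintype ι] [DecidableEq ι] (x : FreeGroupBasis ι F)

/-- The linear coefficients are the coordinates of `w` in the abelianization. The second and third
letters are dummies. -/
theorem mem_γ_two_of_magnusPart_eq_zero {w : F} (hw : ∀ a, magnusPart x a a a w 0 1 = 0) :
    w ∈ γ 2 (⊤ : Subgroup F) := by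
  change w ∈ ⁅(⊤ : Subgroup F), (⊤ : Subgroup F)⁆
  have hHN : ⁅(⊤ : Subgroup F), (⊤ : Subgroup F)⁆ ≤ ⁅(⊤ : Subgroup F), (⊤ : Subgroup F)⁆ := le_rfl
  rw [← toCenter_eq_one_iff hHN ⟨w, Subgroup.mem_top w⟩,
    toCenter_eq_prod hHN (fun a w => magnusPart x a a a w 0 1)
      (fun a g _ h _ => magnusPart_mul_zero_one x a a a g h)
      (fun a => toCenter hHN ⟨x a, Subgroup.mem_top _⟩) (X := Set.range x) (closure_range_basis x).ge ?_]
  · simp [hw]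
  · rintro _ ⟨i, rfl⟩
    refine ⟨Subgroup.mem_top _, ?_⟩
    simp only [magnusPart_basis]
    rw [← prod_zpow_ite_eq (fun a => toCenter hHN ⟨x a, Subgroup.mem_top _⟩) i]
    simp [letterMatrix, eq_comm]

end

/-- An alternating function on pairs is recovered from its values on increasing pairs. -/
theorem prod_pairs {A ι : Type*} [CommGroup A] [Fintype ι] [LinearOrder ι] (T : ι → ι → A)
    (hinv : ∀ a b, T b a = (T a b)⁻¹) (hself : ∀ a, T a a = 1) (i j : ι) :
    ∏ p : ι × ι, (if p.1 < p.2 then T p.1 p.2 else 1) ^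
      ((if p = (i, j) then 1 else 0) - (if p = (j, i) then 1 else 0) : ℤ) = T i j := by
  simp only [zpow_sub, Finset.prod_mul_distrib, Finset.prod_inv_distrib]
  rw [prod_zpow_ite_eq (fun p : ι × ι => if p.1 < p.2 then T p.1 p.2 else 1),
    prod_zpow_ite_eq (fun p : ι × ι => if p.1 < p.2 then T p.1 p.2 else 1)]
  rcases lt_trichotomy i j with h | rfl | h
  · simp [h, h.not_gt]
  · simp [hself]
  · simp [h, h.not_gt, hinv j i]

/-- A function on triples with the symmetries of `⁅⁅c, b⁆, a⁆` is recovered from its values on a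
basic set of triples. -/
theorem prod_triples {A ι : Type*} [CommGroup A] [Fintype ι] [LinearOrder ι] (T : ι → ι → ι → A)
    (hinv : ∀ a b c, T a c b = (T a b c)⁻¹) (hself : ∀ a b, T a b b = 1)
    (hjac : ∀ a b c, T a b c * T b c a * T c a b = 1) (i j k : ι) :
    ∏ p : ι × ι × ι, (if (p.2.2 < p.1 ∧ p.2.2 < p.2.1) ∨ (p.1 = p.2.1 ∧ p.2.1 < p.2.2) then
        T p.1 p.2.1 p.2.2 else 1) ^
      (((if p = (k, j, i) then 1 else 0) - (if p = (j, k, i) then 1 else 0)) -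
        ((if p = (i, k, j) then 1 else 0) - (if p = (i, j, k) then 1 else 0)) : ℤ) = T i j k := by
  have key := prod_zpow_ite_eq (fun p : ι × ι × ι =>
    if (p.2.2 < p.1 ∧ p.2.2 < p.2.1) ∨ (p.1 = p.2.1 ∧ p.2.1 < p.2.2) then
      T p.1 p.2.1 p.2.2 else 1)
  simp only [zpow_sub, Finset.prod_mul_distrib, Finset.prod_inv_distrib, mul_inv_rev, inv_inv]
  simp only [key]
  -- The exponents are the coefficients of the Lie element `kji - jki - ikj + ijk`. If `i` is
  -- strictly least, only `kji` and `jki` can be basic, and the Jacobi relation is needed. In the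
  -- other cases with `j ≠ k`, exactly one of the four words is basic.
  by_cases h1 : i < j ∧ i < k
  · have h2 : T k j i * (T j k i)⁻¹ = T i j k := by
      rw [hinv k i j, ← mul_inv_rev, inv_eq_iff_mul_eq_one, mul_comm, ← mul_assoc]
      exact hjac i j k
    rw [if_pos (by grind), if_pos (by grind), if_neg (by grind), if_neg (by grind), h2]
    simp
  by_cases h2 : j < i ∧ j < k
  · rw [if_neg (by grind), if_neg (by grind), if_neg (by grind), if_pos (by grind), hinv i j k]
    simp
  by_cases h3 : k < i ∧ k < j
  · rw [if_neg (by grind), if_neg (by grind), if_pos (by grind), if_neg (by grind)]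
    simp
  rcases eq_or_ne j k with rfl | hjk
  · simp [hself]
  rcases eq_or_ne i j with hij | hij
  · rw [if_neg (by grind), if_neg (by grind), if_pos (by grind), if_neg (by grind)]
    simp
  · rw [if_neg (by grind), if_neg (by grind), if_neg (by grind), if_pos (by grind), hinv i j k]
    simp

section

variable {ι : Type*} [Fintype ι] [LinearOrder ι] (x : FreeGroupBasis ι F)
variable {N : Subgroup F} [N.Normal]

/-- If `w ∈ γ 2 F` has Magnus coefficients of `ab`, `a < b`, that annihilate `⁅x a, x b⁆` modulo a
normal subgroup `N ≥ γ 3 F`, then `w ∈ N`. -/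
theorem mem_of_magnusPart_zero_two (hN : γ 3 (⊤ : Subgroup F) ≤ N) {w : F}
    (hw : w ∈ γ 2 (⊤ : Subgroup F))
    (h : ∀ a b, a < b → ((⁅x a, x b⁆ : F) : F ⧸ N) ^ magnusPart x a b b w 0 2 = 1) : w ∈ N := by
  have hHN : ⁅γ 2 (⊤ : Subgroup F), (⊤ : Subgroup F)⁆ ≤ N := hN
  have hmem : ∀ a b, ⁅x a, x b⁆ ∈ γ 2 (⊤ : Subgroup F) := fun a b =>
    commutator_mem_lowerCentralSeries_succ (n := 0) (Subgroup.mem_top _) _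
  obtain ⟨T, hT⟩ : ∃ T : ι → ι → Subgroup.center (F ⧸ N),
      ∀ a b, T a b = toCenter hHN ⟨⁅x a, x b⁆, hmem a b⟩ := ⟨_, fun _ _ => rfl⟩
  have hTc : ∀ a b, (T a b : F ⧸ N) = ((⁅x a, x b⁆ : F) : F ⧸ N) := fun a b => by
    rw [hT, coe_toCenter]
  have hTinv : ∀ a b, T b a = (T a b)⁻¹ := fun a b => by
    refine Subtype.ext ?_
    rw [InvMemClass.coe_inv, hTc, hTc, ← commutatorElement_inv (x a) (x b)]
    rfl
  have hself : ∀ a, T a a = 1 := fun a => by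
    refine Subtype.ext ?_
    rw [hTc, commutatorElement_self]
    rfl
  have hadd : ∀ p : ι × ι, ∀ g ∈ γ 2 (⊤ : Subgroup F), ∀ h ∈ γ 2 (⊤ : Subgroup F),
      magnusPart x p.1 p.2 p.2 (g * h) 0 2 =
        magnusPart x p.1 p.2 p.2 g 0 2 + magnusPart x p.1 p.2 p.2 h 0 2 := fun p g hg h hh =>
    magnusPart_mul_apply x _ _ _ (magnusPart_mem_upperBand x _ _ _ 1 hg)
      (magnusPart_mem_upperBand x _ _ _ 1 hh) (by decide)
  have hgen : γ 2 (⊤ : Subgroup F) ≤ _ :=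
    (lowerCentralSeries_one_eq_closure (closure_range_basis x)).le
  -- The entry `(0, 2)` does not depend on the third letter, which is set to `b` as filler.
  have key := toCenter_eq_prod hHN (fun (p : ι × ι) w => magnusPart x p.1 p.2 p.2 w 0 2) hadd
    (fun p => if p.1 < p.2 then T p.1 p.2 else 1) hgen ?_ hw
  · rw [← toCenter_eq_one_iff hHN ⟨w, hw⟩, key]
    refine Finset.prod_eq_one fun p _ => ?_
    split_ifs with hp
    · refine Subtype.ext ?_
      rw [SubgroupClass.coe_zpow, hTc]
      exact h p.1 p.2 hp
    · exact one_zpow _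
  · rintro _ (⟨_, ⟨i, rfl⟩, _, ⟨j, rfl⟩, rfl⟩ | hw)
    · refine ⟨hmem i j, ?_⟩
      have hc : ∀ p : ι × ι, magnusPart x p.1 p.2 p.2 ⁅x i, x j⁆ 0 2 =
          (if p = (i, j) then 1 else 0) - (if p = (j, i) then 1 else 0) := by
        rintro ⟨a, b⟩
        rw [magnusPart_commutator_zero_two, magnusPart_basis, magnusPart_basis]
        by_cases h1 : i = a <;> by_cases h2 : j = b <;> by_cases h3 : j = a <;>
          by_cases h4 : i = b <;> simp [letterMatrix, h1, h2, h3, h4, eq_comm]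
      simp only [hc]
      rw [prod_pairs T hTinv hself]
      exact (hT i j).symm
    · have hw' := Subgroup.lowerCentralSeries_antitone _ (by norm_num : 1 ≤ 2) hw
      refine ⟨hw', ((toCenter_eq_one_iff hHN ⟨_, hw'⟩).2 (hN hw)).trans ?_⟩
      refine (Finset.prod_eq_one fun p _ => ?_).symm
      rw [magnusPart_mem_upperBand x _ _ _ 2 hw 0 2 (by decide), zpow_zero]

/-- If `w ∈ γ 3 F` has Magnus coefficients of the words `abc` with `c < a, b` or `a = b < c` that
annihilate `⁅⁅x c, x b⁆, x a⁆` modulo a normal subgroup `N ≥ γ 4 F`, then `w ∈ N`. -/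
theorem mem_of_magnusPart_zero_three (hN : γ 4 (⊤ : Subgroup F) ≤ N) {w : F}
    (hw : w ∈ γ 3 (⊤ : Subgroup F))
    (h : ∀ a b c, (c < a ∧ c < b) ∨ (a = b ∧ b < c) →
      ((⁅⁅x c, x b⁆, x a⁆ : F) : F ⧸ N) ^ magnusPart x a b c w 0 3 = 1) : w ∈ N := by
  have hHN : ⁅γ 3 (⊤ : Subgroup F), (⊤ : Subgroup F)⁆ ≤ N := hN
  have hmem2 : ∀ g h : F, ⁅g, h⁆ ∈ γ 2 (⊤ : Subgroup F) := fun g h =>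
    commutator_mem_lowerCentralSeries_succ (n := 0) (Subgroup.mem_top _) _
  have hmem : ∀ a b c : F, ⁅⁅c, b⁆, a⁆ ∈ γ 3 (⊤ : Subgroup F) := fun a b c =>
    commutator_mem_lowerCentralSeries_succ (n := 1) (hmem2 c b) _
  have hcen : ∀ a b c : F ⧸ N, ⁅⁅a, b⁆, c⁆ ∈ Subgroup.center (F ⧸ N) := by
    intro a b c
    induction a using QuotientGroup.induction_on with | H a => ?_
    induction b using QuotientGroup.induction_on with | H b => ?_
    induction c using QuotientGroup.induction_on with | H c => ?_
    exact mk_mem_center hHN (hmem c b a)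
  obtain ⟨T, hT⟩ : ∃ T : ι → ι → ι → Subgroup.center (F ⧸ N),
      ∀ a b c, T a b c = toCenter hHN ⟨⁅⁅x c, x b⁆, x a⁆, hmem _ _ _⟩ := ⟨_, fun _ _ _ => rfl⟩
  have hTc : ∀ a b c, (T a b c : F ⧸ N) = ⁅⁅(x c : F ⧸ N), (x b : F ⧸ N)⁆, (x a : F ⧸ N)⁆ :=
    fun a b c => by rw [hT, coe_toCenter]; rfl
  have hTinv : ∀ a b c, T a c b = (T a b c)⁻¹ := fun a b c => by
    refine Subtype.ext ?_
    rw [InvMemClass.coe_inv, hTc, hTc, triple_commutator_swap hcen]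
  have hself : ∀ a b, T a b b = 1 := fun a b => by
    refine Subtype.ext ?_
    rw [hTc, commutatorElement_self, commutatorElement_one_left]
    rfl
  have hjac : ∀ a b c, T a b c * T b c a * T c a b = 1 := fun a b c => by
    refine Subtype.ext ?_
    rw [Subgroup.coe_mul, Subgroup.coe_mul, hTc, hTc, hTc]
    exact triple_commutator_jacobi hcen (x c : F ⧸ N) (x b) (x a)
  have hadd : ∀ p : ι × ι × ι, ∀ g ∈ γ 3 (⊤ : Subgroup F), ∀ h ∈ γ 3 (⊤ : Subgroup F),
      magnusPart x p.1 p.2.1 p.2.2 (g * h) 0 3 =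
        magnusPart x p.1 p.2.1 p.2.2 g 0 3 + magnusPart x p.1 p.2.1 p.2.2 h 0 3 :=
    fun p g hg h hh => magnusPart_mul_apply x _ _ _ (magnusPart_mem_upperBand x _ _ _ 2 hg)
      (magnusPart_mem_upperBand x _ _ _ 2 hh) (by decide)
  have hgen : γ 3 (⊤ : Subgroup F) ≤ _ := lowerCentralSeries_two_le_closure (closure_range_basis x)
  have key := toCenter_eq_prod hHN
    (fun (p : ι × ι × ι) w => magnusPart x p.1 p.2.1 p.2.2 w 0 3) hadd
    (fun p => if (p.2.2 < p.1 ∧ p.2.2 < p.2.1) ∨ (p.1 = p.2.1 ∧ p.2.1 < p.2.2) then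
      T p.1 p.2.1 p.2.2 else 1) hgen ?_ hw
  · rw [← toCenter_eq_one_iff hHN ⟨w, hw⟩, key]
    refine Finset.prod_eq_one fun p _ => ?_
    split_ifs with hp
    · refine Subtype.ext ?_
      rw [SubgroupClass.coe_zpow, hTc]
      exact h p.1 p.2.1 p.2.2 hp
    · exact one_zpow _
  · rintro _ (⟨_, ⟨_, ⟨k, rfl⟩, _, ⟨j, rfl⟩, rfl⟩, _, ⟨i, rfl⟩, rfl⟩ | hw)
    · refine ⟨hmem _ _ _, ?_⟩
      have hc : ∀ p : ι × ι × ι, magnusPart x p.1 p.2.1 p.2.2 ⁅⁅x k, x j⁆, x i⁆ 0 3 =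
          (if p = (k, j, i) then 1 else 0) - (if p = (j, k, i) then 1 else 0) -
          ((if p = (i, k, j) then 1 else 0) - (if p = (i, j, k) then 1 else 0)) := by
        rintro ⟨a, b, c⟩
        rw [magnusPart_commutator_zero_three x _ _ _
            (magnusPart_mem_upperBand x _ _ _ 1 (hmem2 _ _)),
          magnusPart_commutator_zero_two, magnusPart_commutator_one_three]
        simp only [magnusPart_basis, letterMatrix, Prod.mk.injEq, Matrix.of_apply, Matrix.cons_val]
        grind
      simp only [hc]
      rw [prod_triples T hTinv hself hjac]
      exact (hT i j k).symm
    · have hw' := Subgroup.lowerCentralSeries_antitone _ (by norm_num : 2 ≤ 3) hw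
      refine ⟨hw', ((toCenter_eq_one_iff hHN ⟨_, hw'⟩).2 (hN hw)).trans ?_⟩
      refine (Finset.prod_eq_one fun p _ => ?_).symm
      rw [magnusPart_mem_upperBand x _ _ _ 3 hw 0 3 (by decide), zpow_zero]

end

/-! ### The hard inclusions. -/

section

variable {m : ℕ} (x : FreeGroupBasis (Fin m) F) (e : Fin m → ℕ)

theorem γ_two_le_S : γ 2 (⊤ : Subgroup F) ≤ S x e :=
  fun _ h => Subgroup.subset_closure (Or.inr h)

theorem pow_mem_S (i : Fin m) : x i ^ e i ∈ S x e :=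
  Subgroup.subset_closure (Or.inl ⟨i, rfl⟩)

instance S_normal : (S x e).Normal :=
  Subgroup.Normal.of_commutator_le F (γ_two_le_S x e)

instance γ_two_S_normal : (γ 2 (S x e)).Normal :=
  inferInstanceAs (⁅S x e, S x e⁆ : Subgroup F).Normal

instance γ_top_normal (n : ℕ) : (γ n (⊤ : Subgroup F)).Normal :=
  inferInstanceAs ((⊤ : Subgroup F).lowerCentralSeries (n - 1)).Normal

theorem D_three_subset : D 3 (aug (S x e) ^ 2) ⊆
    (γ 2 (S x e) : Set F) * (γ 3 (⊤ : Subgroup F) : Set F) := by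
  intro w hw
  have hw2 : w ∈ γ 2 (⊤ : Subgroup F) := mem_γ_two_of_magnusPart_eq_zero x fun a =>
    magnusPart_zero_one_of_mem_D_three x a a a hw
  rw [← Subgroup.mul_normal]
  refine mem_of_magnusPart_zero_two x le_sup_right hw2 fun a b _ => ?_
  obtain ⟨k, hk⟩ := dvd_magnusPart_of_mem_D_three x e a b b hw
  set N := γ 2 (S x e) ⊔ γ 3 (⊤ : Subgroup F) with hN
  have hHN : ⁅γ 2 (⊤ : Subgroup F), (⊤ : Subgroup F)⁆ ≤ N := le_sup_right (a := γ 2 (S x e))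
  have hcen : ∀ g h : F ⧸ N, ⁅g, h⁆ ∈ Subgroup.center (F ⧸ N) := by
    intro a b
    induction a using QuotientGroup.induction_on with | H a => ?_
    induction b using QuotientGroup.induction_on with | H b => ?_
    exact mk_mem_center hHN (commutator_mem_lowerCentralSeries_succ (n := 0) (Subgroup.mem_top _) _)
  have h1 : ((⁅x a ^ e a, x b ^ e b⁆ : F) : F ⧸ N) = 1 :=
    (QuotientGroup.eq_one_iff _).2 (Subgroup.mem_sup_left
      (Subgroup.commutator_mem_commutator (pow_mem_S x e a) (pow_mem_S x e b)))
  -- Commutators are central in `F ⧸ N`, so both exponents come out as the product `e_a e_b`.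
  have h2 : ⁅(x a : F ⧸ N) ^ e a, (x b : F ⧸ N) ^ e b⁆ = 1 := h1
  rw [commutator_pow_right_of_mem_center (hcen _ _),
    commutator_pow_left_of_mem_center (hcen _ _), ← pow_mul] at h2
  rw [hk, zpow_mul]
  have h3 : ((⁅x a, x b⁆ : F) : F ⧸ N) ^ ((e a : ℤ) * e b) = 1 := by
    exact_mod_cast h2
  rw [h3, one_zpow]

theorem D_four_subset (he : ∀ i j : Fin m, i ≤ j → e j ∣ e i) :
    D 4 (aug (S x e) ^ 2 * (⊤ : Submodule ℤ (MonoidAlgebra ℤ F))) ⊆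
    (γ 2 (S x e) : Set F) * (γ 4 (⊤ : Subgroup F) : Set F) := by
  intro w hw
  -- Part (i) splits off a factor from `γ₂(S)`; the remaining `v ∈ γ₃(F)` still satisfies the
  -- hypothesis of (ii).
  obtain ⟨s, hs, v, hv, rfl⟩ := D_three_subset x e (D_four_subset_D_three _ hw)
  replace hw := mul_mem_D (inv_mem hs) hw
  rw [inv_mul_cancel_left] at hw
  rw [← Subgroup.mul_normal]
  refine mul_mem (Subgroup.mem_sup_left hs) ?_
  refine mem_of_magnusPart_zero_three x le_sup_right hv fun a b c habc => ?_
  -- The basic words are chosen so that either `c < a`, giving `e_a ∣ e_c`, or the word has the form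
  -- `aac`.
  have hdvd : (e a : ℤ) ∣ magnusPart x a b c v 0 3 := by
    rcases habc with ⟨h, _⟩ | ⟨rfl, _⟩
    · exact dvd_magnusPart_of_mem_D_four x e a b c (he c a h.le) hw
    · exact dvd_magnusPart_square_of_mem_D_four x e a c hw hv
  obtain ⟨k, hk⟩ := hdvd
  set N := γ 2 (S x e) ⊔ γ 4 (⊤ : Subgroup F) with hN
  have hHN : ⁅γ 3 (⊤ : Subgroup F), (⊤ : Subgroup F)⁆ ≤ N := le_sup_right (a := γ 2 (S x e))
  have hmem2 : ⁅x c, x b⁆ ∈ γ 2 (⊤ : Subgroup F) :=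
    commutator_mem_lowerCentralSeries_succ (n := 0) (Subgroup.mem_top _) _
  have hcen : ⁅⁅(x c : F ⧸ N), (x b : F ⧸ N)⁆, (x a : F ⧸ N)⁆ ∈ Subgroup.center (F ⧸ N) :=
    mk_mem_center hHN (commutator_mem_lowerCentralSeries_succ (n := 1) hmem2 (x a))
  -- One factor `e_a` suffices, since `⁅x_c, x_b⁆` already lies in `γ₂(F) ≤ S`.
  have h1 : ((⁅⁅x c, x b⁆, x a ^ e a⁆ : F) : F ⧸ N) = 1 :=
    (QuotientGroup.eq_one_iff _).2 (Subgroup.mem_sup_left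
      (Subgroup.commutator_mem_commutator (γ_two_le_S x e hmem2) (pow_mem_S x e a)))
  have h2 : ⁅⁅(x c : F ⧸ N), (x b : F ⧸ N)⁆, (x a : F ⧸ N) ^ e a⁆ = 1 := h1
  rw [commutator_pow_right_of_mem_center hcen] at h2
  rw [hk, zpow_mul]
  have h3 : ((⁅⁅x c, x b⁆, x a⁆ : F) : F ⧸ N) ^ (e a : ℤ) = 1 := by
    exact_mod_cast h2
  rw [h3, one_zpow]

end

end GenDim

end

theorem mainTheorem10 {F : Type*} [Group F] (m : ℕ) (x : FreeGroupBasis (Fin m) F)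
    (e : Fin m → ℕ) (he : ∀ i j : Fin m, i ≤ j → e j ∣ e i) :
    (GenDim.D 3 (GenDim.aug (GenDim.S x e) ^ 2) : Set F) =
        (GenDim.γ 2 (GenDim.S x e) : Set F) * (GenDim.γ 3 (⊤ : Subgroup F) : Set F) ∧
      (GenDim.D 4 (GenDim.aug (GenDim.S x e) ^ 2 * (⊤ : Submodule ℤ (MonoidAlgebra ℤ F))) : Set F) =
        (GenDim.γ 2 (GenDim.S x e) : Set F) * (GenDim.γ 4 (⊤ : Subgroup F) : Set F) :=
  ⟨(GenDim.D_three_subset x e).antisymm (GenDim.γ_mul_γ_subset_D_three _),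
    (GenDim.D_four_subset x e he).antisymm (GenDim.γ_mul_γ_subset_D_four _)⟩
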